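/- For words $y\in\{0,1\}^m$ and $x\in\{0,1\}^n$, let the embedding number $\omega_y(x)$ be the number of index tuples $1\le i_1<\dots<i_m\le n$ with $x_{i_j}=y_j$ for all $j$. Let $m\ge 0$ and $n=m+2$. In the binary 2-deletion channel a word $x\in\{0,1\}^n$ is transmitted and exactly two symbols, whose positions are chosen uniformly at random among the $\binom n2$ pairs, are deleted, so that $\Pr(y\mid x)=\omega_y(x)/\binom n2$ for $y\in\{0,1\}^m$. Let the transmitted word $X$ be uniformly distributed on $\{0,1\}^n$, let $Y$ be the received word, and let $$\mathsf H^{\mathsf{In}}_{2\text{-}\mathsf{Del}}(y)=H(X\mid Y=y)=-\sum_{x\in\{0,1\}^n}\Pr(x\mid y)\log_2\Pr(x\mid y)$$ be the input entropy of $y\in\{0,1\}^m$, where $\Pr(x\mid y)$ is the posterior probability and $0\log_2 0=0$. Then $y\in\{0,1\}^m$ minimizes $\mathsf H^{\mathsf{In}}_{2\text{-}\mathsf{Del}}$ over $\{0,1\}^m$ if and only if $y$ is a constant word $\sigma^m$ with $\sigma\in\{0,1\}$, and for each $\sigma\in\{0,1\}$ $$\min_{y\in\{0,1\}^m}\mathsf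 H^{\mathsf{In}}_{2\text{-}\mathsf{Del}}(y)=\mathsf H^{\mathsf{In}}_{2\text{-}\mathsf{Del}}(\sigma^m)=2+\frac34\log_2\binom n2-\frac12\log_2(m+1).$$ -/

import Mathlib

namespace DeletionChannel

/-- Words of length `n` over the alphabet `{0, …, q - 1}`. -/
abbrev Word (q n : ℕ) : Type := Fin n → Fin q

/-- The embedding number of `y` in `x`: the number of increasing index tuples
`i 0 < i 1 < ⋯ < i (m - 1)` of positions of `x` at which `x` spells `y`. -/
def embeddingNumber {q m n : ℕ} (y : Word q m) (x : Word q n) : ℕ :=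
  (Finset.univ.filter fun i : Fin m → Fin n =>
    (∀ a b, a < b → i a < i b) ∧ ∀ j, x (i j) = y j).card

/-- The constant word `σ^m`. -/
def constWord {q : ℕ} (m : ℕ) (σ : Fin q) : Word q m := fun _ => σ

noncomputable section

/-- The posterior probability that `x` was transmitted given that `y` was received, for a channel
with transition probabilities `W x y = Pr(y received | x transmitted)` and the input
distribution `P`. -/
def posterior {X Y : Type*} [Fintype X] (W : X → Y → ℝ) (P : X → ℝ) (y : Y) (x : X) : ℝ :=
  W x y * P x / ∑ x', W x' y * P x'

/-- The Shannon entropy in bits of a probability mass function on a finite set. -/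
def entropy {X : Type*} [Fintype X] (p : X → ℝ) : ℝ :=
  -∑ x, p x * Real.logb 2 (p x)

/-- The input entropy `H(X | Y = y)` of the received word `y`. -/
def inputEntropy {X Y : Type*} [Fintype X] (W : X → Y → ℝ) (P : X → ℝ) (y : Y) : ℝ :=
  entropy (posterior W P y)

/-- The transition probabilities of the `k`-deletion channel on words of length `m + k`: a set of
exactly `k` positions, chosen uniformly at random, is deleted from the transmitted word `x`. -/
def delChannel (q k m : ℕ) (x : Word q (m + k)) (y : Word q m) : ℝ :=
  (embeddingNumber y x : ℝ) / ((m + k).choose k : ℝ)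

/-- Uniform transmission: every word of length `n` is transmitted with the same probability. -/
def uniformInput (q n : ℕ) (_x : Word q n) : ℝ := 1 / (Fintype.card (Word q n) : ℝ)

/-- The input entropy of `y` over the `k`-deletion channel under uniform transmission. -/
def delInputEntropy (q k m : ℕ) (y : Word q m) : ℝ :=
  inputEntropy (delChannel q k m) (uniformInput q (m + k)) y

end

end DeletionChannel

/-!
For every `y` of length `m` the embedding numbers `ω_y(x)` of the words `x` of length `m + k` add up
to `T = (m + k choose k) * q ^ k`, so the input entropy of `y` is
`log₂ T - (∑ x, ω_y(x) log₂ ω_y(x)) / T`, and since `t ↦ t log₂ t` is strictly convex it is enough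
that the family `ω_y` is strictly majorized by `ω_{σ^m}` unless `y` is constant. For the
majorization, sort the words `x` by their first letter: a first letter other than `y 0` contributes
`ω_y` of the rest of `x`, and the letter `y 0` contributes the sum of `ω_y` and `ω_{tail y}` of the
rest. For a constant word both summands are increasing functions of the number of letters `σ`, hence
comonotone, and majorization passes to sums when the dominating families are comonotone.
Strictness comes from the largest possible value `(m + k choose m)`, which `ω_y` attains only if
`y` is constant.
-/

namespace DeletionChannel

open Finset

/-! ### Weak majorization of integer families -/

section WeakMajorization

variable {ι : Type*}

/-- The equality says that `(t₁, t₂)` is comparable with every point `(f i, g i)`. These points form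
a chain, so from level `t` to `t + 1` one of the two coordinates can be raised. -/
theorem exists_tsub_add_tsub_eq_of_monovary {f g : ι → ℕ} (hfg : Monovary f g) (t : ℕ) :
    ∃ t₁ t₂, t₁ + t₂ = t ∧ ∀ i, (f i - t₁) + (g i - t₂) = f i + g i - t := by
  induction t with
  | zero => exact ⟨0, 0, rfl, fun i => rfl⟩
  | succ t ih =>
    obtain ⟨t₁, t₂, rfl, hsplit⟩ := ih
    by_cases hleft : ∃ i, f i = t₁ ∧ t₂ < g i
    · obtain ⟨i, hfi, hgi⟩ := hleft
      refine ⟨t₁, t₂ + 1, by omega, fun j => ?_⟩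
      have hchain : g j < g i → f j ≤ f i := fun h => hfg h
      have hj := hsplit j
      omega
    · push Not at hleft
      refine ⟨t₁ + 1, t₂, by omega, fun j => ?_⟩
      have hgj := hleft j
      have hj := hsplit j
      omega

/-- This is Taylor's formula with remainder for sequences; the truncated subtraction is the positive
part of `k - (t + 1)`. -/
theorem eq_add_sum_secondDiff_mul_tsub {R : Type*} [CommRing R] (f : ℕ → R) {k N : ℕ}
    (hk : k ≤ N) :
    f k = f 0 + k * (f 1 - f 0) +
      ∑ t ∈ range N, (f (t + 2) - 2 * f (t + 1) + f t) * ((k - (t + 1) : ℕ) : R) := by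
  induction k with
  | zero => simp
  | succ k ih =>
    have htelescope : ∑ t ∈ range k, (f (t + 2) - 2 * f (t + 1) + f t) =
        f (k + 1) - f k - (f 1 - f 0) := by
      rw [← sum_range_sub (fun t => f (t + 1) - f t)]
      exact sum_congr rfl fun t _ => by ring
    have htsub (t : ℕ) :
        ((k + 1 - (t + 1) : ℕ) : R) = ((k - (t + 1) : ℕ) : R) + if t < k then 1 else 0 := by
      rw [show k + 1 - (t + 1) = k - (t + 1) + if t < k then 1 else 0 by split_ifs <;> omega]
      push_cast
      rfl
    have hfilter : {t ∈ range N | t < k} = range k := by grind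
    simp only [htsub, mul_add, mul_ite, mul_one, mul_zero, sum_add_distrib, ← sum_filter, hfilter,
      htelescope]
    push_cast
    linear_combination ih (Nat.le_of_succ_le hk)

theorem secondDiff_pos_of_strictConvexOn {φ : ℝ → ℝ} (hφ : StrictConvexOn ℝ (Set.Ici 0) φ)
    (t : ℕ) : 0 < φ (t + 2 : ℕ) - 2 * φ (t + 1 : ℕ) + φ t := by
  have hslope := hφ.slope_strict_mono_adjacent (x := t) (y := (t + 1 : ℕ)) (z := (t + 2 : ℕ))
    (Set.mem_Ici.2 (by positivity)) (Set.mem_Ici.2 (by positivity)) (by simp) (by simp)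
  push_cast at hslope ⊢
  ring_nf at hslope ⊢
  linarith

variable [Fintype ι]

/-- The family `u` is weakly submajorized by `v` (it precedes `v` in the increasing convex order).
This is expressed through the positive parts `(u i - t)⁺`, which for natural numbers are given by
truncated subtraction. -/
def WeaklyMajorizedBy (u v : ι → ℕ) : Prop :=
  ∀ t, ∑ i, (u i - t) ≤ ∑ i, (v i - t)

namespace WeaklyMajorizedBy

theorem add_of_monovary {u u' v v' : ι → ℕ} (hu : WeaklyMajorizedBy u u')
    (hv : WeaklyMajorizedBy v v') (hmono : Monovary u' v') :
    WeaklyMajorizedBy (u + v) (u' + v') := by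
  intro t
  obtain ⟨t₁, t₂, rfl, hsplit⟩ := exists_tsub_add_tsub_eq_of_monovary hmono t
  calc ∑ i, (u i + v i - (t₁ + t₂))
      ≤ ∑ i, ((u i - t₁) + (v i - t₂)) := sum_le_sum fun i _ => add_tsub_add_le_tsub_add_tsub
    _ = ∑ i, (u i - t₁) + ∑ i, (v i - t₂) := sum_add_distrib
    _ ≤ ∑ i, (u' i - t₁) + ∑ i, (v' i - t₂) := add_le_add (hu t₁) (hv t₂)
    _ = ∑ i, (u' i + v' i - (t₁ + t₂)) := by
      rw [← sum_add_distrib]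
      exact sum_congr rfl fun i _ => hsplit i

theorem sum_lt_sum_of_strictConvexOn {u v : ι → ℕ} (huv : WeaklyMajorizedBy u v)
    (hsum : ∑ i, u i = ∑ i, v i) {s : ℕ} (hs : ∑ i, (u i - s) < ∑ i, (v i - s))
    {φ : ℝ → ℝ} (hφ : StrictConvexOn ℝ (Set.Ici 0) φ) :
    ∑ i, φ (u i) < ∑ i, φ (v i) := by
  obtain ⟨r, rfl⟩ : ∃ r, s = r + 1 := Nat.exists_eq_succ_of_ne_zero (by rintro rfl; simp_all)
  set N := univ.sup u ⊔ univ.sup v ⊔ (r + 1) with hN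
  have hexpand (w : ι → ℕ) (hw : ∀ i, w i ≤ N) : ∑ i, φ (w i) =
      Fintype.card ι * φ 0 + (∑ i, w i : ℕ) * (φ 1 - φ 0) +
        ∑ t ∈ range N, (φ (t + 2 : ℕ) - 2 * φ (t + 1 : ℕ) + φ t) *
          ((∑ i, (w i - (t + 1)) : ℕ) : ℝ) := by
    rw [sum_congr rfl fun i _ => eq_add_sum_secondDiff_mul_tsub (fun k => φ k) (hw i)]
    simp only [sum_add_distrib, sum_comm (s := univ) (t := range N), ← mul_sum, ← sum_mul,
      Nat.cast_sum]
    simp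
  rw [hexpand u fun i => by simp [hN, le_sup (f := u) (mem_univ i)],
    hexpand v fun i => by simp [hN, le_sup (f := v) (mem_univ i)], hsum]
  gcongr 1
  refine sum_lt_sum (fun t _ => ?_) ⟨r, by simp [hN], ?_⟩
  · exact mul_le_mul_of_nonneg_left (mod_cast huv (t + 1))
      (secondDiff_pos_of_strictConvexOn hφ t).le
  · exact mul_lt_mul_of_pos_left (mod_cast hs) (secondDiff_pos_of_strictConvexOn hφ r)

end WeaklyMajorizedBy

end WeakMajorization

/-! ### Embedding numbers -/

section Embeddings

variable {q m n : ℕ}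

/-- The set of increasing index tuples at which `x` spells `y`. It is given by the same filter as
`embeddingNumber`, so that its cardinality is `embeddingNumber y x` by `rfl`. -/
def embeddings (y : Word q m) (x : Word q n) : Finset (Fin m → Fin n) :=
  univ.filter fun i => (∀ a b, a < b → i a < i b) ∧ ∀ j, x (i j) = y j

theorem card_embeddings (y : Word q m) (x : Word q n) : #(embeddings y x) = embeddingNumber y x :=
  rfl

theorem mem_embeddings {y : Word q m} {x : Word q n} {i : Fin m → Fin n} :
    i ∈ embeddings y x ↔ StrictMono i ∧ ∀ j, x (i j) = y j := by
  simp only [embeddings, mem_filter_univ, StrictMono]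

theorem embeddingNumber_zero_left (y : Word q 0) (x : Word q n) : embeddingNumber y x = 1 := by
  simp [embeddingNumber]

theorem embeddingNumber_zero_right (y : Word q (m + 1)) (x : Word q 0) :
    embeddingNumber y x = 0 := by
  rw [← card_embeddings, card_eq_zero]
  exact eq_empty_of_forall_notMem fun i _ => (i 0).elim0

theorem succ_comp_mem_embeddings_cons {y : Word q m} {b : Fin q} {x : Word q n}
    {i : Fin m → Fin n} :
    Fin.succ ∘ i ∈ embeddings y (Fin.cons b x : Word q (n + 1)) ↔ i ∈ embeddings y x := by
  simp [mem_embeddings, StrictMono]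

theorem cons_zero_mem_embeddings_cons {y : Word q (m + 1)} {b : Fin q} {x : Word q n}
    {i : Fin m → Fin n} :
    (Fin.cons 0 (Fin.succ ∘ i) : Fin (m + 1) → Fin (n + 1)) ∈
        embeddings y (Fin.cons b x : Word q (n + 1)) ↔
      b = y 0 ∧ i ∈ embeddings (Fin.tail y) x := by
  have hmono : StrictMono (Fin.cons 0 (Fin.succ ∘ i) : Fin (m + 1) → Fin (n + 1)) ↔
      StrictMono i := by
    rw [Fin.strictMono_cons]
    simp [StrictMono]
  simp only [mem_embeddings, hmono, Fin.forall_fin_succ, Fin.cons_zero, Fin.cons_succ,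
    Function.comp_apply, Fin.tail]
  tauto

theorem exists_eq_succ_comp_or_eq_cons_zero {i : Fin (m + 1) → Fin (n + 1)} (hi : StrictMono i) :
    (∃ i' : Fin (m + 1) → Fin n, i = Fin.succ ∘ i') ∨
      ∃ i' : Fin m → Fin n, i = Fin.cons 0 (Fin.succ ∘ i') := by
  have htail (j : Fin m) : ∃ k, Fin.succ k = i j.succ :=
    Fin.exists_succ_eq_of_ne_zero (Fin.ne_zero_of_lt (hi j.succ_pos))
  choose i' hi' using htail
  by_cases h0 : i 0 = 0
  · refine .inr ⟨i', funext fun j => ?_⟩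
    cases j using Fin.cases <;> simp [h0, hi']
  · obtain ⟨k, hk⟩ := Fin.exists_succ_eq_of_ne_zero h0
    refine .inl ⟨Fin.cons k i', funext fun j => ?_⟩
    cases j using Fin.cases <;> simp [hk, hi']

theorem embeddingNumber_cons (y : Word q (m + 1)) (b : Fin q) (x : Word q n) :
    embeddingNumber y (Fin.cons b x : Word q (n + 1)) =
      embeddingNumber y x + if b = y 0 then embeddingNumber (Fin.tail y) x else 0 := by
  let skipFirst (i : Fin (m + 1) → Fin n) : Fin (m + 1) → Fin (n + 1) := Fin.succ ∘ i
  let useFirst (i : Fin m → Fin n) : Fin (m + 1) → Fin (n + 1) := Fin.cons 0 (Fin.succ ∘ i)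
  have hskip : skipFirst.Injective := (Fin.succ_injective n).comp_left
  have huse : useFirst.Injective :=
    (Fin.cons_right_injective 0).comp (Fin.succ_injective n).comp_left
  have hdisjoint (i i') : skipFirst i ≠ useFirst i' := fun h =>
    Fin.succ_ne_zero (i 0) (congrFun h 0)
  have hunion : embeddings y (Fin.cons b x : Word q (n + 1)) =
      (embeddings y x).image skipFirst ∪
        (if b = y 0 then embeddings (Fin.tail y) x else ∅).image useFirst := by
    ext i
    constructor
    · intro hi
      rcases exists_eq_succ_comp_or_eq_cons_zero (mem_embeddings.1 hi).1 with
        ⟨i', rfl⟩ | ⟨i', rfl⟩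
      · exact mem_union_left _ (mem_image_of_mem _ (succ_comp_mem_embeddings_cons.1 hi))
      · obtain ⟨hb, hi'⟩ := cons_zero_mem_embeddings_cons.1 hi
        exact mem_union_right _ (mem_image_of_mem _ (by rwa [if_pos hb]))
    · simp only [mem_union, mem_image]
      rintro (⟨i', hi', rfl⟩ | ⟨i', hi', rfl⟩)
      · exact succ_comp_mem_embeddings_cons.2 hi'
      · split_ifs at hi' with hb
        · exact cons_zero_mem_embeddings_cons.2 ⟨hb, hi'⟩
        · exact absurd hi' (notMem_empty i')
  rw [← card_embeddings, hunion, card_union_of_disjoint, card_image_of_injective _ hskip,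
    card_image_of_injective _ huse, apply_ite card, card_empty]
  · rfl
  · simp only [disjoint_left, mem_image]
    rintro _ ⟨i, -, rfl⟩ ⟨i', -, h⟩
    exact hdisjoint i i' h.symm

end Embeddings

/-! ### Constant words -/

section ConstantWords

variable {q m n : ℕ}

/-- The number of occurrences of the letter `σ` in `x`, on which alone the embedding numbers of
the constant words `σ^m` in `x` depend. -/
def letterCount (σ : Fin q) (x : Word q n) : ℕ := #{i | x i = σ}

theorem letterCount_cons (σ b : Fin q) (x : Word q n) :
    letterCount σ (Fin.cons b x : Word q (n + 1)) =
      letterCount σ x + if b = σ then 1 else 0 := by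
  simp only [letterCount, Fin.card_filter_univ_succ', Fin.cons_zero, Fin.cons_succ, add_comm]

theorem letterCount_constWord (σ : Fin q) (n : ℕ) : letterCount σ (constWord n σ) = n := by
  simp [letterCount, constWord]

theorem embeddingNumber_constWord (m : ℕ) (σ : Fin q) (x : Word q n) :
    embeddingNumber (constWord m σ) x = (letterCount σ x).choose m := by
  induction n generalizing m with
  | zero => cases m <;> simp [embeddingNumber_zero_left, embeddingNumber_zero_right, letterCount]
  | succ n ih =>
    obtain ⟨b, x, rfl⟩ : ∃ b x', x = Fin.cons b x' := ⟨_, _, (Fin.cons_self_tail x).symm⟩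
    cases m with
    | zero => simp [embeddingNumber_zero_left]
    | succ m =>
      have htail : Fin.tail (constWord (m + 1) σ) = constWord m σ := rfl
      have hhead : constWord (m + 1) σ 0 = σ := rfl
      rw [embeddingNumber_cons, letterCount_cons, htail, hhead, ih, ih]
      split_ifs
      · rw [Nat.choose_succ_succ, add_comm]
      · rfl

theorem monovary_embeddingNumber_constWord (l m n : ℕ) (σ : Fin q) :
    Monovary (fun x : Word q n => embeddingNumber (constWord l σ) x)
      (fun x => embeddingNumber (constWord m σ) x) := by
  simp only [embeddingNumber_constWord]
  exact ((Nat.choose_mono l).monovary (Nat.choose_mono m)).comp_right (letterCount σ)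

/-- Over the one-letter alphabet every increasing tuple is an embedding, so there are
`n.choose m` increasing tuples, and the hypothesis says that all of them are embeddings of `y`. -/
theorem apply_eq_of_choose_le_embeddingNumber {y : Word q m} {x : Word q n}
    (h : n.choose m ≤ embeddingNumber y x) {i : Fin m → Fin n} (hi : StrictMono i) (j : Fin m) :
    x (i j) = y j := by
  have hsub : embeddings y x ⊆ embeddings (constWord m (0 : Fin 1)) (constWord n 0) := fun i hi =>
    mem_embeddings.2 ⟨(mem_embeddings.1 hi).1, fun _ => rfl⟩
  have hcard : #(embeddings (constWord m (0 : Fin 1)) (constWord n 0)) ≤ #(embeddings y x) := by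
    rwa [card_embeddings, card_embeddings, embeddingNumber_constWord, letterCount_constWord]
  have hmem : i ∈ embeddings y x := by
    rw [eq_of_subset_of_card_le hsub hcard]
    exact mem_embeddings.2 ⟨hi, fun _ => rfl⟩
  exact (mem_embeddings.1 hmem).2 j

/-- Adjacent letters of `y` can be embedded at the same position of `x`: through the first `m`
positions and through their shift by one. -/
theorem exists_eq_constWord_of_choose_le_embeddingNumber [NeZero q] (hmn : m < n) {y : Word q m}
    {x : Word q n} (h : n.choose m ≤ embeddingNumber y x) : ∃ σ, y = constWord m σ := by
  cases m with
  | zero => exact ⟨0, Subsingleton.elim _ _⟩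
  | succ m =>
    refine ⟨y 0, funext fun j => ?_⟩
    induction j using Fin.induction with
    | zero => rfl
    | succ j ih =>
      have hinit := apply_eq_of_choose_le_embeddingNumber h (Fin.strictMono_castLE hmn.le) j.succ
      have hshift := apply_eq_of_choose_le_embeddingNumber h (i := Fin.castLE hmn ∘ Fin.succ)
        ((Fin.strictMono_castLE hmn).comp Fin.strictMono_succ) j.castSucc
      exact (hinit.symm.trans hshift).trans ih

end ConstantWords

/-! ### Sums over all words -/

section WordSums

variable {q m n : ℕ}

theorem sum_word_succ {M : Type*} [AddCommMonoid M] (a : Fin q) {F : Word q (n + 1) → M}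
    {f g : Word q n → M} (hf : ∀ x, F (Fin.cons a x) = f x)
    (hg : ∀ b ≠ a, ∀ x, F (Fin.cons b x) = g x) :
    ∑ x, F x = ∑ x, f x + (q - 1) • ∑ x, g x := by
  have hne : ∑ b ∈ {a}ᶜ, ∑ x : Word q n, F (Fin.cons b x) =
      ∑ b ∈ ({a}ᶜ : Finset (Fin q)), ∑ x, g x :=
    sum_congr rfl fun b hb => sum_congr rfl fun x _ => hg b (by simpa using hb) x
  rw [← (Fin.consEquiv fun _ : Fin (n + 1) => Fin q).sum_comp, Fintype.sum_prod_type,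
    Fintype.sum_eq_add_sum_compl a]
  simp only [Fin.consEquiv, Equiv.coe_fn_mk, hne, hf, sum_const, card_compl, card_singleton,
    Fintype.card_fin]

theorem sum_embeddingNumber_succ {M : Type*} [AddCommMonoid M] (g : ℕ → M) (y : Word q (m + 1)) :
    ∑ x : Word q (n + 1), g (embeddingNumber y x) =
      ∑ x : Word q n, g (embeddingNumber y x + embeddingNumber (Fin.tail y) x) +
        (q - 1) • ∑ x : Word q n, g (embeddingNumber y x) :=
  sum_word_succ (y 0) (fun x => by simp [embeddingNumber_cons])
    fun b hb x => by simp [embeddingNumber_cons, hb]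

theorem sum_letterCount {M : Type*} [AddCommMonoid M] (σ : Fin q) (g : ℕ → M) (n : ℕ) :
    ∑ x : Word q n, g (letterCount σ x) =
      ∑ w ∈ range (n + 1), (n.choose w * (q - 1) ^ (n - w)) • g w := by
  suffices ∑ x : Word q n, g (letterCount σ x) =
      ∑ ij ∈ antidiagonal n, n.choose ij.1 • (q - 1) ^ ij.2 • g ij.1 by
    simpa only [mul_smul, Nat.sum_antidiagonal_eq_sum_range_succ_mk] using this
  induction n generalizing g with
  | zero => simp [letterCount]
  | succ n ih =>
    have hcons : ∑ x : Word q (n + 1), g (letterCount σ x) =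
        ∑ x : Word q n, g (letterCount σ x + 1) + (q - 1) • ∑ x : Word q n, g (letterCount σ x) :=
      sum_word_succ σ (fun x => by simp [letterCount_cons])
        fun b hb x => by simp [letterCount_cons, hb]
    rw [hcons, ih, ih fun w => g (w + 1), add_comm, smul_sum,
      sum_antidiagonal_choose_succ_nsmul fun i j => (q - 1) ^ j • g i]
    congr 1
    · exact sum_congr rfl fun ij _ => by rw [pow_succ', mul_smul, smul_comm]
    · refine sum_congr rfl fun ij hij => ?_
      rw [Nat.choose_symm_of_eq_add (mem_antidiagonal.1 hij).symm]

theorem pow_mul_sum_embeddingNumber (n : ℕ) (y : Word q m) :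
    q ^ m * ∑ x : Word q n, embeddingNumber y x = n.choose m * q ^ n := by
  induction n generalizing m with
  | zero => cases m <;> simp [embeddingNumber_zero_left, embeddingNumber_zero_right]
  | succ n ih =>
    cases m with
    | zero => simp [embeddingNumber_zero_left]
    | succ m =>
      have hq : 1 + (q - 1) = q := by have := (y 0).pos; omega
      have hsame := ih y
      have htail := ih (Fin.tail y)
      rw [sum_embeddingNumber_succ (fun k => k), Nat.choose_succ_succ, sum_add_distrib,
        add_right_comm, smul_eq_mul, ← one_add_mul, hq]
      rw [pow_succ] at hsame ⊢
      rw [pow_succ q n]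
      linear_combination q * hsame + q * htail

theorem sum_embeddingNumber [NeZero q] (k : ℕ) (y : Word q m) :
    ∑ x : Word q (m + k), embeddingNumber y x = (m + k).choose k * q ^ k := by
  refine Nat.eq_of_mul_eq_mul_left (pow_pos (NeZero.pos q) m) ?_
  rw [pow_mul_sum_embeddingNumber, pow_add, Nat.choose_symm_add, mul_left_comm]

theorem weaklyMajorizedBy_embeddingNumber_constWord (σ : Fin q) (n : ℕ) (y : Word q m) :
    WeaklyMajorizedBy (fun x : Word q n => embeddingNumber y x)
      (fun x => embeddingNumber (constWord m σ) x) := by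
  induction n generalizing m with
  | zero =>
    cases m <;> intro t <;> simp [embeddingNumber_zero_left, embeddingNumber_zero_right]
  | succ n ih =>
    cases m with
    | zero => intro t; simp [embeddingNumber_zero_left]
    | succ m =>
      intro t
      simp only [sum_embeddingNumber_succ (· - t)]
      gcongr ?_ + _ • ?_
      · exact (ih y).add_of_monovary (ih (Fin.tail y))
          (monovary_embeddingNumber_constWord (m + 1) m n σ) t
      · exact ih y t

theorem sum_tsub_embeddingNumber_lt_constWord (hmn : m < n) {y : Word q m}
    (hy : ¬ ∃ σ, y = constWord m σ) (σ : Fin q) :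
    ∑ x : Word q n, (embeddingNumber y x - (n.choose m - 1)) <
      ∑ x : Word q n, (embeddingNumber (constWord m σ) x - (n.choose m - 1)) := by
  have : NeZero q := ⟨σ.pos.ne'⟩
  have hlt (x : Word q n) : embeddingNumber y x < n.choose m :=
    lt_of_not_ge fun h => hy (exists_eq_constWord_of_choose_le_embeddingNumber hmn h)
  have hmax : embeddingNumber (constWord m σ) (constWord n σ) = n.choose m := by
    rw [embeddingNumber_constWord, letterCount_constWord]
  rw [sum_eq_zero fun x _ => Nat.sub_eq_zero_of_le (Nat.le_sub_one_of_lt (hlt x))]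
  refine sum_pos' (fun _ _ => Nat.zero_le _) ⟨constWord n σ, mem_univ _, ?_⟩
  have := Nat.choose_pos hmn.le
  omega

end WordSums

/-! ### Input entropy -/

section InputEntropy

theorem strictConvexOn_mul_logb {b : ℝ} (hb : 1 < b) :
    StrictConvexOn ℝ (Set.Ici 0) fun x => x * Real.logb b x := by
  refine ⟨convex_Ici 0, fun x hx y hy hxy s t hs ht hst => ?_⟩
  have h := div_lt_div_of_pos_right (Real.strictConvexOn_mul_log.2 hx hy hxy hs ht hst)
    (Real.log_pos hb)
  simp only [smul_eq_mul, Real.logb] at h ⊢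
  linear_combination h

theorem entropy_div_sum {X : Type*} [Fintype X] (u : X → ℝ) (hu : ∑ x, u x ≠ 0) :
    entropy (fun x => u x / ∑ x', u x') =
      Real.logb 2 (∑ x, u x) - (∑ x, u x * Real.logb 2 (u x)) / ∑ x, u x := by
  set T := ∑ x, u x with hT
  have hterm (x : X) : u x / T * Real.logb 2 (u x / T) =
      u x * Real.logb 2 (u x) / T - u x * (Real.logb 2 T / T) := by
    by_cases hx : u x = 0
    · simp [hx]
    · rw [Real.logb_div hx hu]
      ring
  simp only [entropy, hterm, sum_sub_distrib, ← sum_div, ← sum_mul, ← hT, mul_div_cancel₀ _ hu]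
  ring

variable {q k m : ℕ}

theorem posterior_delChannel_uniformInput (y : Word q m) :
    posterior (delChannel q k m) (uniformInput q (m + k)) y =
      fun x => (embeddingNumber y x : ℝ) / ∑ x' : Word q (m + k), (embeddingNumber y x' : ℝ) := by
  funext x
  have hchoose : ((m + k).choose k : ℝ) ≠ 0 :=
    mod_cast (Nat.choose_pos (Nat.le_add_left k m)).ne'
  have : Nonempty (Word q (m + k)) := ⟨x⟩
  have hcard : (Fintype.card (Word q (m + k)) : ℝ) ≠ 0 := mod_cast Fintype.card_ne_zero
  simp only [posterior, delChannel, uniformInput, ← sum_mul, ← sum_div]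
  field_simp

theorem delInputEntropy_eq [NeZero q] (y : Word q m) :
    delInputEntropy q k m y = Real.logb 2 ((m + k).choose k * q ^ k) -
      (∑ x : Word q (m + k), embeddingNumber y x * Real.logb 2 (embeddingNumber y x)) /
        ((m + k).choose k * q ^ k) := by
  have hsum : ∑ x : Word q (m + k), (embeddingNumber y x : ℝ) = (m + k).choose k * q ^ k :=
    mod_cast sum_embeddingNumber k y
  have hpos : 0 < (m + k).choose k * q ^ k :=
    mul_pos (Nat.choose_pos (Nat.le_add_left k m)) (pow_pos (NeZero.pos q) k)
  have hne : ∑ x : Word q (m + k), (embeddingNumber y x : ℝ) ≠ 0 := by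
    rw [hsum]
    exact_mod_cast hpos.ne'
  rw [delInputEntropy, inputEntropy, posterior_delChannel_uniformInput, entropy_div_sum _ hne, hsum]

/-- The input entropy of the constant words of length `m` over the `k`-deletion channel with `q`
letters. The sum is the mean of `log₂ (m + j choose j)` when the number `j` of deleted symbols
equal to the received letter is binomially distributed with parameters `k` and `1 / q`. -/
noncomputable def constWordEntropy (q k m : ℕ) : ℝ :=
  Real.logb 2 ((m + k).choose k) + k * Real.logb 2 q -
    (∑ j ∈ range (k + 1),
      k.choose j * (q - 1 : ℝ) ^ (k - j) * Real.logb 2 ((m + j).choose j)) / q ^ k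

theorem sum_choose_letterCount (σ : Fin q) (k m : ℕ) (φ : ℕ → ℝ) :
    ∑ x : Word q (m + k), ((letterCount σ x).choose m : ℝ) * φ (letterCount σ x) =
      (m + k).choose k *
        ∑ j ∈ range (k + 1), k.choose j * (q - 1 : ℝ) ^ (k - j) * φ (m + j) := by
  have hlow (w) (hw : w ∈ range m) : (w.choose m : ℝ) = 0 :=
    mod_cast Nat.choose_eq_zero_of_lt (mem_range.1 hw)
  have htrinomial (j : ℕ) :
      (m + k).choose (m + j) * (m + j).choose m = (m + k).choose k * k.choose j := by
    rw [Nat.choose_mul (Nat.le_add_right m j), Nat.add_sub_cancel_left, Nat.add_sub_cancel_left,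
      Nat.choose_symm_add]
  have hq : ((q - 1 : ℕ) : ℝ) = q - 1 := Nat.cast_pred σ.pos
  rw [sum_letterCount σ (fun w => (w.choose m : ℝ) * φ w), add_assoc m k 1, sum_range_add,
    sum_eq_zero fun w hw => by rw [hlow w hw, zero_mul, smul_zero], zero_add, mul_sum]
  refine sum_congr rfl fun j _ => ?_
  have := congrArg (Nat.cast (R := ℝ)) (htrinomial j)
  rw [nsmul_eq_mul, Nat.add_sub_add_left]
  push_cast [hq] at this ⊢
  linear_combination (q - 1 : ℝ) ^ (k - j) * φ (m + j) * this

theorem delInputEntropy_constWord (σ : Fin q) :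
    delInputEntropy q k m (constWord m σ) = constWordEntropy q k m := by
  have : NeZero q := ⟨σ.pos.ne'⟩
  have hchoose : ((m + k).choose k : ℝ) ≠ 0 :=
    mod_cast (Nat.choose_pos (Nat.le_add_left k m)).ne'
  have hq : (q : ℝ) ≠ 0 := NeZero.ne _
  simp only [delInputEntropy_eq, embeddingNumber_constWord]
  rw [sum_choose_letterCount σ k m (fun w => Real.logb 2 (w.choose m)),
    mul_div_mul_left _ _ hchoose, Real.logb_mul hchoose (pow_ne_zero k hq), Real.logb_pow]
  simp only [constWordEntropy, Nat.choose_symm_add (a := m)]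

theorem delInputEntropy_constWord_lt (hk : 0 < k) {y : Word q m}
    (hy : ¬ ∃ σ, y = constWord m σ) (σ : Fin q) :
    delInputEntropy q k m (constWord m σ) < delInputEntropy q k m y := by
  have : NeZero q := ⟨σ.pos.ne'⟩
  have hsum : ∑ x : Word q (m + k), embeddingNumber y x * Real.logb 2 (embeddingNumber y x) <
      ∑ x : Word q (m + k), embeddingNumber (constWord m σ) x *
        Real.logb 2 (embeddingNumber (constWord m σ) x) :=
    (weaklyMajorizedBy_embeddingNumber_constWord σ (m + k) y).sum_lt_sum_of_strictConvexOn
      (by rw [sum_embeddingNumber, sum_embeddingNumber])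
      (sum_tsub_embeddingNumber_lt_constWord (Nat.lt_add_of_pos_right hk) hy σ)
      (strictConvexOn_mul_logb one_lt_two)
  have hchoose : 0 < (m + k).choose k := Nat.choose_pos (Nat.le_add_left k m)
  have hq : 0 < q := NeZero.pos q
  rw [delInputEntropy_eq, delInputEntropy_eq]
  gcongr

theorem constWordEntropy_two_two (m : ℕ) :
    constWordEntropy 2 2 m =
      2 + 3 / 4 * Real.logb 2 ((m + 2).choose 2) - 1 / 2 * Real.logb 2 (m + 1) := by
  have hlog : Real.logb 2 2 = 1 := Real.logb_self_eq_one one_lt_two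
  norm_num [constWordEntropy, sum_range_succ, hlog]
  ring

end InputEntropy

end DeletionChannel

open DeletionChannel in
theorem mainTheorem2_general (q k m : ℕ) [NeZero q] (hk : 0 < k) :
    (∀ y : Word q m, (∀ z, delInputEntropy q k m y ≤ delInputEntropy q k m z) ↔
      ∃ σ, y = constWord m σ) ∧
    (∀ σ : Fin q, delInputEntropy q k m (constWord m σ) = constWordEntropy q k m) ∧
    IsLeast (Set.range (delInputEntropy q k m)) (constWordEntropy q k m) := by
  have hmin (z : Word q m) : constWordEntropy q k m ≤ delInputEntropy q k m z := by
    by_cases hz : ∃ σ, z = constWord m σ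
    · obtain ⟨σ, rfl⟩ := hz
      exact (delInputEntropy_constWord σ).ge
    · rw [← delInputEntropy_constWord 0]
      exact (delInputEntropy_constWord_lt hk hz 0).le
  refine ⟨fun y => ⟨fun hy => ?_, ?_⟩, delInputEntropy_constWord,
    ⟨_, delInputEntropy_constWord 0⟩, Set.forall_mem_range.2 hmin⟩
  · by_contra hconst
    exact (hy _).not_gt (delInputEntropy_constWord_lt hk hconst 0)
  · rintro ⟨σ, rfl⟩ z
    exact (delInputEntropy_constWord σ).trans_le (hmin z)

theorem mainTheorem2 (m n : ℕ) (hn : n = m + 2) :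
    (∀ y : DeletionChannel.Word 2 m,
      (∀ z : DeletionChannel.Word 2 m,
        DeletionChannel.delInputEntropy 2 2 m y ≤ DeletionChannel.delInputEntropy 2 2 m z) ↔
      ∃ σ : Fin 2, y = DeletionChannel.constWord m σ) ∧
    (∀ σ : Fin 2, DeletionChannel.delInputEntropy 2 2 m (DeletionChannel.constWord m σ) =
      2 + 3 / 4 * Real.logb 2 (n.choose 2 : ℝ) - 1 / 2 * Real.logb 2 ((m : ℝ) + 1)) ∧
    IsLeast (Set.range (DeletionChannel.delInputEntropy 2 2 m))
      (2 + 3 / 4 * Real.logb 2 (n.choose 2 : ℝ) - 1 / 2 * Real.logb 2 ((m : ℝ) + 1)) := by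
  subst hn
  simpa only [DeletionChannel.constWordEntropy_two_two] using mainTheorem2_general 2 2 m two_pos
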